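/- Let $F_n$ be the free group on $x_1,\dots,x_n$ and call $x_1,\dots,x_n,x_1^{-1},\dots,x_n^{-1}$ the letters. For a letter $a$ and a set $A$ of letters containing neither $a$ nor $a^{-1}$, the Whitehead automorphism $\varphi=(A,a)$ of $F_n$ is given by $\varphi(a)=a$ and $\varphi(x_j)=a^{\varepsilon_j}x_ja^{-\delta_j}$ for $x_j\neq a^{\pm1}$, where $\varepsilon_j=1$ if $x_j\in A$ and $\varepsilon_j=0$ otherwise, and $\delta_j=1$ if $x_j^{-1}\in A$ and $\delta_j=0$ otherwise. The Whitehead graph of a cyclically reduced word $w=b_1\cdots b_l$ has the $2n$ letters as vertices, with an arc joining $b_i^{-1}$ and $b_{i+1}$ for each $i=1,\dots,l$ (where $b_{l+1}=b_1$). A vertex $a$ of it is a cut vertex if it is not isolated and either its connected component does not contain $a^{-1}$, or its connected component becomes disconnected when $a$ is removed. The cyclic length of an element of $F_n$ is the length of its cyclic reduction. Let $w=b_1\cdots b_l$ be a cyclically reduced word in $F_n$. (1) If $w$ is primitive (that is, belongs to some basis of $F_n$) and is not a single letter, then the Whitehead graph of $w$ contains a cut vertex. (2) If the Whitehead graph of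 $w$ contains a cut vertex, then there is a Whitehead automorphism $\varphi=(A,a)$ such that the cyclic length of $\varphi(w)$ is strictly smaller than the cyclic length of $w$, and such that moreover every letter $a$ or $a^{-1}$ that is added when $\varphi$ is applied to $w$ letter by letter immediately cancels in the cyclic reduction. The last condition means: in the unreduced word $\varphi(b_1)\cdots\varphi(b_l)$, read cyclically, there are pairwise disjoint pairs of adjacent positions, each carrying two mutually inverse letters, such that every added letter belongs to one of these pairs. -/

import Mathlib

namespace WhiteheadFine

/-- The `2n` letters `x_1, …, x_n` and their inverses: `(i, true)` is the generator `x_i` and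
`(i, false)` is its inverse. Words are lists of letters, as in `FreeGroup`. -/
abbrev Letter (n : ℕ) : Type := Fin n × Bool

/-- The formal inverse of a letter. -/
def Letter.bar {n : ℕ} (x : Letter n) : Letter n := (x.1, !x.2)

/-- An element of `F_n` is primitive if it belongs to some basis of `F_n`. -/
def IsPrimitive {n : ℕ} (g : FreeGroup (Fin n)) : Prop :=
  ∃ (ι : Type) (b : FreeGroupBasis ι (FreeGroup (Fin n))) (i : ι), b i = g

/-- The cyclic length of `g`: the length of the cyclic reduction of its reduced word. -/
def cyclicLength {n : ℕ} (g : FreeGroup (Fin n)) : ℕ :=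
  (FreeGroup.reduceCyclically g.toWord).length

/-! ### The Whitehead graph -/

/-- `z` comes right after `y` somewhere in the list `w`, read cyclically (the first entry follows
the last one). -/
def CyclicallyConsecutive {α : Type} (w : List α) (y z : α) : Prop :=
  ∃ i : ℕ, w[i]? = some y ∧ w[(i + 1) % w.length]? = some z

/-- The Whitehead graph of a cyclically reduced word `w`, up to multiplicities of arcs (which play
no role for cut vertices): the vertices are the `2n` letters, and for each pair `y, z` of
cyclically consecutive letters of `w` there is an arc between `y.bar` and `z`. When `w` is
cyclically reduced such an arc is never a loop. -/
def whiteheadGraph {n : ℕ} (w : List (Letter n)) : SimpleGraph (Letter n) :=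
  SimpleGraph.fromRel fun u v => CyclicallyConsecutive w u.bar v

/-- The vertex `a` is a cut vertex of the graph `G` on the set of letters: it is not isolated and
either its connected component does not contain `a.bar`, or its connected component
becomes disconnected when `a` is removed. -/
def IsCutVertex {n : ℕ} (G : SimpleGraph (Letter n)) (a : Letter n) : Prop :=
  (∃ b, G.Adj a b) ∧
    (¬ G.Reachable a a.bar ∨ ¬ (G.induce {v | G.Reachable a v ∧ v ≠ a}).Preconnected)

/-! ### Whitehead automorphisms -/

/-- The data `(A, a)` of a Whitehead automorphism: an acting letter `a`, and a set `A` of letters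
containing neither `a` nor its inverse. -/
structure WhiteheadData (n : ℕ) where
  a : Letter n
  A : Finset (Letter n)
  a_notMem : a ∉ A
  bar_a_notMem : a.bar ∉ A

namespace WhiteheadData

variable {n : ℕ}

/-- The endomorphism of `F_n` multiplying the generator `x_j` on the left by `c` if `x_j ∈ A`, and
on the right by `c⁻¹` if the inverse of `x_j` is in `A`. -/
def endo (φ : WhiteheadData n) (c : FreeGroup (Fin n)) : FreeGroup (Fin n) →* FreeGroup (Fin n) :=
  FreeGroup.lift fun j =>
    (if (j, true) ∈ φ.A then c else 1) * FreeGroup.of j * (if (j, false) ∈ φ.A then c⁻¹ else 1)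

theorem endo_acting (φ : WhiteheadData n) (c : FreeGroup (Fin n)) :
    φ.endo c (FreeGroup.mk [φ.a]) = FreeGroup.mk [φ.a] := by
  obtain ⟨⟨k, s⟩, A, h, h'⟩ := φ
  cases s <;> simp only [Letter.bar, Bool.not_true, Bool.not_false] at h h' <;>
    simp [endo, FreeGroup.lift_mk, h, h', FreeGroup.of, FreeGroup.invRev]

theorem endo_endo (φ : WhiteheadData n) (c d : FreeGroup (Fin n)) (hd : φ.endo c d = d)
    (hcd : d * c = 1) : (φ.endo c).comp (φ.endo d) = MonoidHom.id _ := by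
  have hc : c = d⁻¹ := (inv_eq_of_mul_eq_one_right hcd).symm
  subst hc
  ext j
  have hj : φ.endo d⁻¹ (FreeGroup.of j) = (if (j, true) ∈ φ.A then d⁻¹ else 1) *
      FreeGroup.of j * (if (j, false) ∈ φ.A then d else 1) := by
    simp [endo]
  have hj' : φ.endo d (FreeGroup.of j) = (if (j, true) ∈ φ.A then d else 1) *
      FreeGroup.of j * (if (j, false) ∈ φ.A then d⁻¹ else 1) := by
    simp [endo]
  rw [MonoidHom.comp_apply, hj', map_mul, map_mul, hj, MonoidHom.id_apply]
  split_ifs <;> simp [hd, mul_assoc]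

/-- The Whitehead automorphism `(A, a)`: it fixes `a`, and it maps each other generator `x_j` to
`x_j`, `a x_j`, `x_j a⁻¹` or `a x_j a⁻¹`, the factor `a` being there if and only if `x_j ∈ A`, and
the factor `a⁻¹` being there if and only if `x_j⁻¹ ∈ A`. -/
def toAut (φ : WhiteheadData n) : FreeGroup (Fin n) ≃* FreeGroup (Fin n) :=
  MonoidHom.toMulEquiv (φ.endo (FreeGroup.mk [φ.a])) (φ.endo (FreeGroup.mk [φ.a])⁻¹)
    (φ.endo_endo _ _ (φ.endo_acting _) (mul_inv_cancel _))
    (φ.endo_endo _ _ (by rw [map_inv, endo_acting]) (inv_mul_cancel _))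

end WhiteheadData

/-! ### Applying a Whitehead automorphism letter by letter -/

/-- A letter in the image of a word, together with the information whether it was added
(`added = true`) or was already there in the original word (`added = false`). -/
structure MarkedLetter (n : ℕ) where
  letter : Letter n
  added : Bool

namespace WhiteheadData

variable {n : ℕ}

/-- The image of one letter `x` under `(A, a)`, as an unreduced marked word: an `a` is added
before `x` if `x ∈ A`, and an `a.bar` is added after `x` if `x.bar ∈ A`. -/
def letterImage (φ : WhiteheadData n) (x : Letter n) : List (MarkedLetter n) :=
  (if x ∈ φ.A then [⟨φ.a, true⟩] else []) ++ [⟨x, false⟩] ++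
    (if x.bar ∈ φ.A then [⟨φ.a.bar, true⟩] else [])

/-- The result of applying `(A, a)` to the word `w` letter by letter, without any reduction. -/
def wordImage (φ : WhiteheadData n) (w : List (Letter n)) : List (MarkedLetter n) :=
  w.flatMap φ.letterImage

theorem mk_letterImage (φ : WhiteheadData n) (x : Letter n) :
    FreeGroup.mk ((φ.letterImage x).map MarkedLetter.letter) = φ.toAut (FreeGroup.mk [x]) := by
  have ha : (FreeGroup.mk [φ.a])⁻¹ = FreeGroup.mk [φ.a.bar] := by
    simp [FreeGroup.invRev, Letter.bar]
  have e : φ.toAut (FreeGroup.mk [x]) = φ.endo (FreeGroup.mk [φ.a]) (FreeGroup.mk [x]) := rfl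
  obtain ⟨j, s⟩ := x
  rw [e, endo, FreeGroup.lift_mk, ha]
  by_cases h₁ : (j, true) ∈ φ.A <;> by_cases h₂ : (j, false) ∈ φ.A <;> cases s <;>
    simp [letterImage, h₁, h₂, FreeGroup.of, FreeGroup.invRev, Letter.bar]

/-- The word obtained letter by letter does represent the image under the automorphism. -/
theorem mk_wordImage (φ : WhiteheadData n) (w : List (Letter n)) :
    FreeGroup.mk ((φ.wordImage w).map MarkedLetter.letter) = φ.toAut (FreeGroup.mk w) := by
  induction w with
  | nil => exact (map_one φ.toAut).symm
  | cons x w ih =>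
    have h : FreeGroup.mk (x :: w) = FreeGroup.mk [x] * FreeGroup.mk w := by
      rw [FreeGroup.mul_mk]; rfl
    rw [h, map_mul, ← ih, ← mk_letterImage, FreeGroup.mul_mk, wordImage, List.flatMap_cons,
      List.map_append]
    rfl

end WhiteheadData

/-- In the marked word `s`, read cyclically, the letters in the adjacent positions `i` and `i + 1`
are inverse to each other, so that they can be cancelled in one move of the cyclic reduction. -/
def CancelsAt {n : ℕ} (s : List (MarkedLetter n)) (i : ℕ) : Prop :=
  ∃ y z : MarkedLetter n, s[i]? = some y ∧ s[(i + 1) % s.length]? = some z ∧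
    z.letter = y.letter.bar

/-- Every added letter of the marked word `s` immediately cancels in the cyclic reduction: there is
a set `P` of positions such that the pairs of cyclically adjacent positions `(i, i + 1)`, `i ∈ P`,
are pairwise disjoint, each of them carries two mutually inverse letters, and every added letter
belongs to one of these pairs. (Two different pairs `(i, i + 1)` and `(j, j + 1)` meet if and only
if one of `i`, `j` is the cyclic successor of the other.) -/
def AddedLettersCancel {n : ℕ} (s : List (MarkedLetter n)) : Prop :=
  ∃ P : Set ℕ,
    (∀ i ∈ P, CancelsAt s i) ∧
    (∀ i ∈ P, (i + 1) % s.length ∉ P) ∧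
    ∀ (k : ℕ) (y : MarkedLetter n), s[k]? = some y → y.added = true →
      ∃ i ∈ P, k = i ∨ k = (i + 1) % s.length

end WhiteheadFine

namespace WhiteheadFine

/-! ### Letters, inverse words and reduced words. -/

variable {n : ℕ}

/-! Cut vertex from primitivity. In the Cayley tree of a basis containing w, the edge from 1 to w
splits the group into two halves. The indicator f of a half changes under right multiplication by w
only at 1, and under any fixed element at only finitely many places (`exists_jump_function`). Now
view f on the Cayley tree of x_1, …, x_n. Along a line spelled by powers of w, sampled once per
period, f is constant unless 1 is a sample point. The lines through a vertex p join pairs of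
directions at p, and these pairs are exactly the arcs of the Whitehead graph. If there is no cut
vertex, then after deleting the direction back to the root the remaining directions stay connected
by arcs, so descending induction on the length of p makes f eventually constant on every cone away
from the root (`exists_eventuallyOnCone`). At the root only the turn from the last letter of w to
the first one jumps. Without cut vertices this leaves just two directions, so w is a power of a
letter, and if its length is at least 2, a second parallel arc without a jump gives a contradiction.

Shortening from a cut vertex. A cut vertex a provides a set A of letters, avoiding a and its
inverse, that arcs leave only towards a (`IsCutVertex.exists_whiteheadData`). Hence in the image of
w every added inverse of a is followed by a, and every added a is preceded by its inverse. An arc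
between A and a makes an added letter cancel an original one, which is where length is lost
(`cyclicLength_toAut_lt`). -/

@[simp]
theorem Letter.bar_bar (x : Letter n) : x.bar.bar = x := by simp [Letter.bar]

theorem Letter.bar_ne (x : Letter n) : x.bar ≠ x := by
  intro h
  have := congrArg Prod.snd h
  simp [Letter.bar] at this

theorem Letter.bar_injective : Function.Injective (Letter.bar (n := n)) := fun x y h => by
  rw [← x.bar_bar, h, y.bar_bar]

/-- The condition on adjacent letters in Mathlib's definition of reduced words. -/
theorem Letter.ne_bar_iff (x y : Letter n) : y ≠ x.bar ↔ (x.1 = y.1 → x.2 = y.2) := by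
  obtain ⟨i, s⟩ := x
  obtain ⟨j, t⟩ := y
  cases s <;> cases t <;> simp [Letter.bar, eq_comm]

theorem invRev_append (u v : List (Letter n)) :
    FreeGroup.invRev (u ++ v) = FreeGroup.invRev v ++ FreeGroup.invRev u := by
  simp [FreeGroup.invRev]

theorem invRev_singleton (x : Letter n) : FreeGroup.invRev [x] = [x.bar] := by
  simp [FreeGroup.invRev, Letter.bar]

theorem isReduced_invRev {L : List (Letter n)} (h : FreeGroup.IsReduced L) :
    FreeGroup.IsReduced (FreeGroup.invRev L) := by
  rw [FreeGroup.isReduced_iff_reduce_eq, FreeGroup.reduce_invRev, h.reduce_eq]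

theorem mk_ne_one_of_isReduced {L : List (Letter n)} (h : FreeGroup.IsReduced L) (hL : L ≠ []) :
    FreeGroup.mk L ≠ 1 := by
  intro e
  have := congrArg FreeGroup.toWord e
  rw [FreeGroup.toWord_mk, h.reduce_eq, FreeGroup.toWord_one] at this
  exact hL this

theorem mk_append (u v : List (Letter n)) :
    FreeGroup.mk (u ++ v) = FreeGroup.mk u * FreeGroup.mk v := FreeGroup.mul_mk.symm

theorem isReduced_append_singleton_iff (p : List (Letter n)) (x y : Letter n) :
    FreeGroup.IsReduced (p ++ [x] ++ [y]) ↔ FreeGroup.IsReduced (p ++ [x]) ∧ y ≠ x.bar := by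
  rw [Letter.ne_bar_iff, FreeGroup.IsReduced, FreeGroup.IsReduced, List.isChain_append]
  simp

/-! ### Turns of a cyclic word -/

/-- Rotate a cyclic word so that a given pair of consecutive letters are the last and the first. -/
theorem CyclicallyConsecutive.exists_split {α : Type} {w : List α} {x z : α}
    (h : CyclicallyConsecutive w x z) :
    ∃ u v m, w = u ++ z :: v ∧ z :: v ++ u = m ++ [x] := by
  obtain ⟨i, hi, hz⟩ := h
  obtain ⟨hil, hi⟩ := List.getElem?_eq_some_iff.1 hi
  by_cases hl : i + 1 < w.length
  · rw [Nat.mod_eq_of_lt hl] at hz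
    obtain ⟨_, hz⟩ := List.getElem?_eq_some_iff.1 hz
    refine ⟨w.take (i + 1), w.drop (i + 2), z :: w.drop (i + 2) ++ w.take i, ?_, ?_⟩
    · rw [← hz, List.getElem_cons_drop, List.take_append_drop]
    · rw [List.take_add_one, List.getElem?_eq_getElem hil, hi]; simp
  · have hl' : i + 1 = w.length := by omega
    rw [hl', Nat.mod_self] at hz
    cases w with
    | nil => simp at hil
    | cons b w =>
      obtain rfl : b = z := by simpa using hz
      refine ⟨[], w, (b :: w).take i, rfl, ?_⟩
      have := List.take_append_drop i (b :: w)
      rw [List.append_nil]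
      conv_lhs => rw [← this, ← List.getElem_cons_drop hil, hi, hl', List.drop_length]

/-- The index itself is kept, not only the pair of letters, because the cancelling pairs in the
unreduced image are specified by position. -/
theorem exists_getElem?_of_split {α : Type} {u v m : List α} {x z : α}
    (h : z :: v ++ u = m ++ [x]) :
    ∃ i, (u ++ z :: v)[i]? = some x ∧ (i + 1) % (u ++ z :: v).length = u.length := by
  rcases List.eq_nil_or_concat u with rfl | ⟨u, y, rfl⟩
  · refine ⟨v.length, ?_, by simp⟩
    have : (z :: v)[v.length]? = (m ++ [x])[v.length]? := by rw [← h, List.append_nil]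
    have hm : v.length = m.length := by simpa using congrArg List.length h
    simpa [hm] using this
  · have e : y = x := by
      have := congrArg List.getLast? h
      rw [List.concat_eq_append, ← List.append_assoc, List.getLast?_concat,
        List.getLast?_concat] at this
      exact Option.some_injective _ this
    subst e
    exact ⟨u.length, by simp, by rw [Nat.mod_eq_of_lt (by simp)]; simp⟩

theorem cyclicallyConsecutive_of_split {α : Type} {u v m : List α} {x z : α}
    (h : z :: v ++ u = m ++ [x]) : CyclicallyConsecutive (u ++ z :: v) x z := by
  obtain ⟨i, hi, hi'⟩ := exists_getElem?_of_split h
  exact ⟨i, hi, by rw [hi']; simp⟩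

theorem CyclicallyConsecutive.ne_bar {w : List (Letter n)} (hw : FreeGroup.IsCyclicallyReduced w)
    {x z : Letter n} (h : CyclicallyConsecutive w x z) : z ≠ x.bar := by
  obtain ⟨i, hi, hz⟩ := h
  rw [Letter.ne_bar_iff]
  obtain ⟨hil, hi⟩ := List.getElem?_eq_some_iff.1 hi
  by_cases hl : i + 1 < w.length
  · rw [Nat.mod_eq_of_lt hl] at hz
    obtain ⟨_, hz⟩ := List.getElem?_eq_some_iff.1 hz
    have := List.isChain_iff_getElem.1 hw.isReduced i hl
    rwa [hi, hz] at this
  · have hl' : i + 1 = w.length := by omega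
    rw [hl', Nat.mod_self] at hz
    refine hw.2 x ?_ z ?_
    · rw [List.getLast?_eq_getElem?, ← hl']
      simpa [hi] using List.getElem?_eq_getElem hil
    · rw [List.head?_eq_getElem?]; exact hz

theorem whiteheadGraph_adj {w : List (Letter n)} {y z : Letter n}
    (h : (whiteheadGraph w).Adj y z) :
    CyclicallyConsecutive w y.bar z ∨ CyclicallyConsecutive w z.bar y :=
  ((SimpleGraph.fromRel_adj _ _ _).1 h).2

theorem CyclicallyConsecutive.adj {w : List (Letter n)} (hw : FreeGroup.IsCyclicallyReduced w)
    {x z : Letter n} (h : CyclicallyConsecutive w x z) : (whiteheadGraph w).Adj x.bar z :=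
  (SimpleGraph.fromRel_adj _ _ _).2 ⟨(h.ne_bar hw).symm, Or.inl (by rwa [Letter.bar_bar])⟩

/-! ### A function with a single jump along the powers of a basis element -/

theorem FreeGroupBasis.induction {G ι : Type*} [Group G] (b : FreeGroupBasis ι G) {P : G → Prop}
    (one : P 1) (basis : ∀ i, P (b i)) (mul : ∀ x y, P x → P y → P (x * y))
    (inv : ∀ x, P x → P x⁻¹) (g : G) : P g := by
  have key : ∀ x : FreeGroup ι, P (b.repr.symm x) := by
    intro x
    induction x using FreeGroup.induction_on with
    | C1 => simpa using one
    | of i => exact basis i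
    | inv_of i h => rw [map_inv]; exact inv _ h
    | mul x y hx hy => rw [map_mul]; exact mul _ _ hx hy
  simpa using key (b.repr g)

/-- Freeness lets basis elements act by arbitrary permutations: they act on a two-sheeted cover of
`G`, switching sheets only across one edge. Then `f` is the parity of crossings of the edge from `1`
to `b i₀`. -/
theorem exists_jump_function {G ι : Type*} [Group G] (b : FreeGroupBasis ι G) (i₀ : ι) :
    ∃ f : G → ZMod 2, (∀ g, g ≠ 1 → f (g * b i₀) = f g) ∧ f (b i₀) ≠ f 1 ∧
      ∀ x, {g | f (g * x) ≠ f g}.Finite := by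
  classical
  let c : ι → G → ZMod 2 := fun i g => if i = i₀ ∧ b i * g = 1 then 1 else 0
  let ρ : G →* Equiv.Perm (G × ZMod 2) := b.lift fun i =>
    { toFun := fun q => (b i * q.1, q.2 + c i q.1)
      invFun := fun q => ((b i)⁻¹ * q.1, q.2 - c i ((b i)⁻¹ * q.1))
      left_inv := fun q => by simp
      right_inv := fun q => by simp }
  have hρ : ∀ i q, ρ (b i) q = (b i * q.1, q.2 + c i q.1) := fun i q => by
    simp [ρ, FreeGroupBasis.lift]
  -- The action is by left translation; the inverse turns it into a statement about right
  -- multiplication.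
  let f : G → ZMod 2 := fun g => (ρ g⁻¹ (1, 0)).2
  have hfst : ∀ g q, (ρ g q).1 = g * q.1 := by
    intro g
    induction g using FreeGroupBasis.induction b with
    | one => simp
    | basis i => simp [hρ]
    | mul x y hx hy => intro q; rw [map_mul, Equiv.Perm.mul_apply, hx, hy, mul_assoc]
    | inv x hx =>
      intro q
      have := hx (ρ x⁻¹ q)
      rw [← Equiv.Perm.mul_apply, ← map_mul, mul_inv_cancel, map_one, Equiv.Perm.one_apply] at this
      rw [this, inv_mul_cancel_left]
  have hf : ∀ g i, f g = f (g * b i) + if i = i₀ ∧ g = 1 then 1 else 0 := by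
    intro g i
    have e : g⁻¹ = b i * (g * b i)⁻¹ := by group
    have : ρ g⁻¹ (1, 0) = ρ (b i) (ρ (g * b i)⁻¹ (1, 0)) := by
      rw [← Equiv.Perm.mul_apply, ← map_mul, ← e]
    simp only [f]
    rw [this, hρ, hfst]
    simp [c]
  refine ⟨f, fun g hg => ?_, fun h => ?_, fun x => ?_⟩
  · simpa [hg] using (hf g i₀).symm
  · have := hf 1 i₀
    rw [one_mul, h] at this
    simp at this
  · induction x using FreeGroupBasis.induction b with
    | one => simp
    | basis i =>
      refine (Set.finite_singleton 1).subset fun g hg => ?_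
      by_contra hg1
      apply hg
      simpa [show g ≠ 1 from hg1] using (hf g i).symm
    -- A change under `x * y` at `g` forces a change under `x` at `g` or under `y` at `g * x`.
    | mul x y hx hy =>
      refine (hx.union (hy.preimage (f := fun g => g * x)
        (mul_left_injective x).injOn)).subset fun g hg => ?_
      by_contra hc
      simp only [Set.mem_union, Set.mem_ofPred_eq, Set.mem_preimage, not_or, not_not] at hc
      exact hg (by rw [← mul_assoc, hc.2, hc.1])
    | inv x hx =>
      refine (hx.preimage (f := fun g => g * x⁻¹) (mul_left_injective x⁻¹).injOn).subset
        fun g hg => ?_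
      simp only [Set.mem_preimage, Set.mem_ofPred_eq, inv_mul_cancel_right]
      exact fun h => hg h.symm

/-! ### Cones in the Cayley tree and their eventual values -/

/-- The reduced words with letters in `C` and with prefix `p`. -/
def cone (C : Set (Letter n)) (p : List (Letter n)) : Set (List (Letter n)) :=
  {L | FreeGroup.IsReduced L ∧ (∀ x ∈ L, x ∈ C) ∧ p <+: L}

/-- The function `f` takes the value `t` at all but finitely many elements of the cone of `p`. -/
def EventuallyOnCone {β : Type*} (f : FreeGroup (Fin n) → β) (C : Set (Letter n))
    (p : List (Letter n)) (t : β) : Prop :=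
  {L | L ∈ cone C p ∧ f (FreeGroup.mk L) ≠ t}.Finite

section Cones

variable {β : Type*} {f : FreeGroup (Fin n) → β} {C : Set (Letter n)}

theorem EventuallyOnCone.eq_of_injective {p : List (Letter n)} {t s : β}
    (h : EventuallyOnCone f C p t) {A : ℕ → List (Letter n)} (hA : Function.Injective A)
    (hp : ∀ k, A k ∈ cone C p) (hs : ∀ k, f (FreeGroup.mk (A k)) = s) : t = s := by
  by_contra hne
  refine Set.infinite_range_of_injective hA (h.subset ?_)
  rintro _ ⟨k, rfl⟩
  exact ⟨hp k, by rw [hs]; exact Ne.symm hne⟩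

theorem mem_cone_cases {p L : List (Letter n)} (h : L ∈ cone C p) :
    L = p ∨ ∃ y ∈ C, FreeGroup.IsReduced (p ++ [y]) ∧ L ∈ cone C (p ++ [y]) := by
  obtain ⟨hr, hC, r, rfl⟩ := h
  cases r with
  | nil => simp
  | cons y r =>
    refine Or.inr ⟨y, hC y (by simp), hr.infix ⟨[], r, by simp⟩, hr, hC, r, by simp⟩

/-- The alphabet is finite, so a cone is its apex together with finitely many smaller cones. -/
theorem EventuallyOnCone.of_extensions {p : List (Letter n)} {t : β}
    (h : ∀ y ∈ C, FreeGroup.IsReduced (p ++ [y]) → EventuallyOnCone f C (p ++ [y]) t) :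
    EventuallyOnCone f C p t := by
  have hfin : ({p} ∪ ⋃ y ∈ {y | y ∈ C ∧ FreeGroup.IsReduced (p ++ [y])},
      {L | L ∈ cone C (p ++ [y]) ∧ f (FreeGroup.mk L) ≠ t}).Finite :=
    (Set.finite_singleton p).union ((Set.toFinite _).biUnion fun y hy => h y hy.1 hy.2)
  refine hfin.subset fun L hL => ?_
  rcases mem_cone_cases hL.1 with rfl | ⟨y, hy, hr, hLy⟩
  · exact Or.inl rfl
  · exact Or.inr (Set.mem_biUnion (show y ∈ {y | _} from ⟨hy, hr⟩) ⟨hLy, hL.2⟩)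

theorem exists_eventuallyOnCone_of_length_ge (hf : ∀ x, {g | f (g * x) ≠ f g}.Finite) :
    ∃ N : ℕ, ∀ p : List (Letter n), N ≤ p.length →
      EventuallyOnCone f C p (f (FreeGroup.mk p)) := by
  have hfin : (⋃ x : Letter n, {g | f (g * FreeGroup.mk [x]) ≠ f g}).Finite :=
    Set.finite_iUnion fun x => hf _
  obtain ⟨N, hN⟩ := (hfin.image fun g => g.toWord.length).bddAbove
  -- All places where `f` changes along an edge have length at most `N`; beyond that length `f` is
  -- constant on the cone, not merely eventually so.
  refine ⟨N + 1, fun p hp => ?_⟩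
  have key : ∀ r, FreeGroup.IsReduced (p ++ r) →
      f (FreeGroup.mk (p ++ r)) = f (FreeGroup.mk p) := by
    intro r
    induction r using List.reverseRecOn with
    | nil => simp
    | append_singleton r x ih =>
      intro hr
      have hr' : FreeGroup.IsReduced (p ++ r) := hr.infix ⟨[], [x], by simp⟩
      rw [← ih hr', ← List.append_assoc, mk_append]
      by_contra hne
      have := hN ⟨_, Set.mem_iUnion.2 ⟨x, hne⟩, rfl⟩
      simp only [FreeGroup.toWord_mk, hr'.reduce_eq, List.length_append] at this
      omega
  refine Set.finite_empty.subset ?_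
  rintro L ⟨⟨hr, -, r, rfl⟩, hL⟩
  exact hL (key r hr)

/-! ### The lines of a cyclic word through a vertex of the Cayley tree -/

theorem isReduced_forward {w u v p : List (Letter n)} {z : Letter n}
    (hw : FreeGroup.IsCyclicallyReduced w) (hu : w = u ++ z :: v)
    (hz : FreeGroup.IsReduced (p ++ [z])) (k : ℕ) :
    FreeGroup.IsReduced (p ++ z :: v ++ (List.replicate k w).flatten) := by
  have h : FreeGroup.IsReduced ([z] ++ (v ++ (List.replicate k w).flatten)) := by
    refine (hw.flatten_replicate (k + 1)).isReduced.infix ⟨u, [], ?_⟩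
    rw [List.replicate_succ, List.flatten_cons]
    nth_rewrite 2 [hu]
    simp
  simpa using FreeGroup.IsReduced.append_overlap hz h (by simp)

theorem isReduced_backward {w u v m p : List (Letter n)} {x z : Letter n}
    (hw : FreeGroup.IsCyclicallyReduced w) (hu : w = u ++ z :: v) (hm : z :: v ++ u = m ++ [x])
    (hx : FreeGroup.IsReduced (p ++ [x.bar])) (k : ℕ) :
    FreeGroup.IsReduced
      (p ++ [x.bar] ++ FreeGroup.invRev ((List.replicate k w).flatten ++ u ++ m)) := by
  refine FreeGroup.IsReduced.append_overlap hx ?_ (by simp)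
  rw [← invRev_singleton, ← invRev_append, List.append_assoc, ← hm]
  refine isReduced_invRev ((hw.flatten_replicate (k + 2)).isReduced.infix ⟨[], z :: v, ?_⟩)
  rw [List.replicate_succ', List.replicate_succ', List.flatten_concat, List.flatten_concat]
  simp [hu]

/-- Exposes the first letter of the backward ray, hence the cone it enters. -/
theorem invRev_backward {w u v m : List (Letter n)} {x z : Letter n}
    (hu : w = u ++ z :: v) (hm : z :: v ++ u = m ++ [x]) (k : ℕ) :
    FreeGroup.invRev ((List.replicate (k + 1) w).flatten ++ u) =
      [x.bar] ++ FreeGroup.invRev ((List.replicate k w).flatten ++ u ++ m) := by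
  rw [← invRev_singleton, ← invRev_append, List.append_assoc, ← hm,
    List.replicate_succ', List.flatten_concat]
  congr 1
  simp [hu]

theorem mk_flatten_replicate_succ (w : List (Letter n)) (k : ℕ) :
    FreeGroup.mk (List.replicate (k + 1) w).flatten =
      FreeGroup.mk (List.replicate k w).flatten * FreeGroup.mk w := by
  rw [List.replicate_succ', List.flatten_concat, mk_append]

theorem forall_mem_flatten_replicate {w : List (Letter n)} (hw : ∀ x ∈ w, x ∈ C) (k : ℕ) :
    ∀ x ∈ (List.replicate k w).flatten, x ∈ C := by
  intro x hx
  obtain ⟨l, hl, hx⟩ := List.mem_flatten.1 hx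
  exact hw x (List.eq_of_mem_replicate hl ▸ hx)

theorem forall_mem_invRev {L : List (Letter n)} (hC : ∀ x ∈ C, x.bar ∈ C) (hL : ∀ x ∈ L, x ∈ C) :
    ∀ x ∈ FreeGroup.invRev L, x ∈ C := by
  intro x hx
  simp only [FreeGroup.invRev, List.mem_reverse, List.mem_map] at hx
  obtain ⟨y, hy, rfl⟩ := hx
  exact hC y (hL y hy)

/-- The ray from `p` reading `z :: v` and then copies of `w` stays in the cone, and `f` agrees at
all its period ends, none of which is `1`. -/
theorem eventual_value_forward {w u v p : List (Letter n)} {z : Letter n}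
    (hw : FreeGroup.IsCyclicallyReduced w) (hwC : ∀ x ∈ w, x ∈ C) (hpC : ∀ x ∈ p, x ∈ C)
    (hf : ∀ g, g ≠ 1 → f (g * FreeGroup.mk w) = f g)
    (hu : w = u ++ z :: v) (hz : FreeGroup.IsReduced (p ++ [z])) {t : β}
    (ht : EventuallyOnCone f C (p ++ [z]) t) : t = f (FreeGroup.mk (p ++ z :: v)) := by
  have hl : 0 < w.length := by simp [hu]
  refine ht.eq_of_injective (A := fun k => p ++ z :: v ++ (List.replicate k w).flatten)
    (fun k l h => ?_) (fun k => ⟨isReduced_forward hw hu hz k, fun x hx => ?_, ?_⟩) (fun k => ?_)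
  · have := congrArg List.length h
    simpa [hl.ne'] using this
  · rcases List.mem_append.1 hx with hx | hx
    · rcases List.mem_append.1 hx with hx | hx
      · exact hpC x hx
      · exact hwC x (hu ▸ List.mem_append_right u hx)
    · exact forall_mem_flatten_replicate hwC k x hx
  · exact ⟨v ++ (List.replicate k w).flatten, by simp⟩
  · induction k with
    | zero => simp
    | succ k ih =>
      rw [← ih]
      rw [mk_append _ (List.replicate (k + 1) w).flatten, mk_flatten_replicate_succ, ← mul_assoc,
        ← mk_append]
      exact hf _ (mk_ne_one_of_isReduced (isReduced_forward hw hu hz k) (by simp))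

/-- The same along the opposite ray. The sample point `p ++ invRev u` may be `1`, but `hf` is only
applied at later, nontrivial points. -/
theorem eventual_value_backward {w u v m p : List (Letter n)} {x z : Letter n}
    (hw : FreeGroup.IsCyclicallyReduced w) (hwC : ∀ x ∈ w, x ∈ C) (hpC : ∀ x ∈ p, x ∈ C)
    (hC : ∀ x ∈ C, x.bar ∈ C) (hf : ∀ g, g ≠ 1 → f (g * FreeGroup.mk w) = f g)
    (hu : w = u ++ z :: v) (hm : z :: v ++ u = m ++ [x])
    (hx : FreeGroup.IsReduced (p ++ [x.bar])) {t : β}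
    (ht : EventuallyOnCone f C (p ++ [x.bar]) t) :
    t = f (FreeGroup.mk (p ++ FreeGroup.invRev u)) := by
  have hl : 0 < w.length := by simp [hu]
  have hred : ∀ k, FreeGroup.IsReduced
      (p ++ FreeGroup.invRev ((List.replicate (k + 1) w).flatten ++ u)) := fun k => by
    rw [invRev_backward hu hm, ← List.append_assoc]
    exact isReduced_backward hw hu hm hx k
  have hstep : ∀ k, f (FreeGroup.mk (p ++
      FreeGroup.invRev ((List.replicate k w).flatten ++ u))) = f (FreeGroup.mk (p ++
      FreeGroup.invRev ((List.replicate (k + 1) w).flatten ++ u))) := by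
    intro k
    rw [← hf _ (mk_ne_one_of_isReduced (hred k)
      (by rw [invRev_backward hu hm]; simp))]
    congr 1
    rw [mk_append p, mk_append p, ← FreeGroup.inv_mk, ← FreeGroup.inv_mk, mk_append, mk_append,
      List.replicate_succ, List.flatten_cons, mk_append]
    group
  refine ht.eq_of_injective
    (A := fun k => p ++ FreeGroup.invRev ((List.replicate (k + 1) w).flatten ++ u))
    (fun k l h => ?_) (fun k => ⟨hred k, fun x hx => ?_, ?_⟩) (fun k => ?_)
  · have := congrArg List.length h
    simpa [hl.ne'] using this
  · rcases List.mem_append.1 hx with hx | hx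
    · exact hpC x hx
    · refine forall_mem_invRev hC (fun y hy => ?_) x hx
      rcases List.mem_append.1 hy with hy | hy
      · exact forall_mem_flatten_replicate hwC _ y hy
      · exact hwC y (hu ▸ List.mem_append_left _ hy)
  · rw [invRev_backward hu hm]
    exact ⟨FreeGroup.invRev ((List.replicate k w).flatten ++ u ++ m), by simp⟩
  · induction k with
    | zero => rw [← hstep 0]; simp
    | succ k ih => rw [← ih]; exact (hstep (k + 1)).symm

end Cones

/-! ### Whitehead graphs without cut vertices -/

/-- Deleting a non-cut vertex leaves its component connected, so a function preserved by the
remaining arcs is constant there. -/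
theorem eq_of_forall_adj {G : SimpleGraph (Letter n)} {a y z : Letter n} {β : Type*}
    {h : Letter n → β} (ha : ¬ IsCutVertex G a) (hadj : ∃ b, G.Adj a b)
    (hh : ∀ y z, G.Reachable a y → G.Reachable a z → y ≠ a → z ≠ a → G.Adj y z → h y = h z)
    (hy : G.Reachable a y) (hya : y ≠ a) (hz : G.Reachable a z) (hza : z ≠ a) : h y = h z := by
  have hpre : (G.induce {v | G.Reachable a v ∧ v ≠ a}).Preconnected := by
    by_contra hc
    exact ha ⟨hadj, Or.inr hc⟩
  obtain ⟨p⟩ := hpre ⟨y, hy, hya⟩ ⟨z, hz, hza⟩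
  have key : ∀ {u v : {v | G.Reachable a v ∧ v ≠ a}},
      (G.induce {v | G.Reachable a v ∧ v ≠ a}).Walk u v → h u = h v := by
    intro u v p
    induction p with
    | nil => rfl
    | @cons u v _ e _ ih => rw [← ih]; exact hh _ _ u.2.1 v.2.1 u.2.2 v.2.2 e
  exact key p

theorem exists_adj_of_reachable {V : Type*} {G : SimpleGraph V} {u v : V} (h : G.Reachable u v)
    (hu : ∃ b, G.Adj u b) : ∃ b, G.Adj v b := by
  obtain ⟨p⟩ := h.symm
  cases p with
  | nil => exact hu
  | cons e _ => exact ⟨_, e⟩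

theorem reachable_bar {G : SimpleGraph (Letter n)} {a : Letter n} (ha : ¬ IsCutVertex G a)
    (hadj : ∃ b, G.Adj a b) : G.Reachable a a.bar := by
  by_contra hc
  exact ha ⟨hadj, Or.inl hc⟩

/-- Walk along the word: a non-cut vertex is connected to its inverse, which has an arc to the next
letter. -/
theorem reachable_of_mem {b : Letter n} {w : List (Letter n)}
    (hw : FreeGroup.IsCyclicallyReduced (b :: w))
    (hcut : ∀ a, ¬ IsCutVertex (whiteheadGraph (b :: w)) a)
    (hb : ∃ c, (whiteheadGraph (b :: w)).Adj b c) {x : Letter n} (hx : x ∈ b :: w) :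
    (whiteheadGraph (b :: w)).Reachable b x := by
  obtain ⟨i, hi, rfl⟩ := List.mem_iff_getElem.1 hx
  clear hx
  induction i with
  | zero => rfl
  | succ i ih =>
    have hi' : i < (b :: w).length := by omega
    have hr := ih hi'
    refine hr.trans ((reachable_bar (hcut _) (exists_adj_of_reachable hr hb)).trans ?_)
    have : CyclicallyConsecutive (b :: w) (b :: w)[i] (b :: w)[i + 1] :=
      ⟨i, List.getElem?_eq_getElem hi',
        by rw [Nat.mod_eq_of_lt hi]; exact List.getElem?_eq_getElem hi⟩
    exact (this.adj hw).reachable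

/-! ### Eventual values along a Whitehead graph without cut vertices -/

section Values

variable {β : Type*} {f : FreeGroup (Fin n) → β} {C : Set (Letter n)} {w : List (Letter n)}

/-- The forward and backward values are those of `f` at two sample points differing by right
multiplication by `w`. The earlier one is `1` only when `p` and `u` are both empty, which `hpu`
excludes. -/
theorem eventual_values_eq_of_turn (hw : FreeGroup.IsCyclicallyReduced w)
    (hwC : ∀ x ∈ w, x ∈ C) (hC : ∀ x ∈ C, x.bar ∈ C)
    (hf : ∀ g, g ≠ 1 → f (g * FreeGroup.mk w) = f g) {p u v m : List (Letter n)} {x z : Letter n}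
    (hpC : ∀ x ∈ p, x ∈ C) (hu : w = u ++ z :: v) (hm : z :: v ++ u = m ++ [x])
    (hz : FreeGroup.IsReduced (p ++ [z])) (hx : FreeGroup.IsReduced (p ++ [x.bar]))
    (hpu : p ≠ [] ∨ u ≠ []) {s t : β} (hs : EventuallyOnCone f C (p ++ [x.bar]) s)
    (ht : EventuallyOnCone f C (p ++ [z]) t) : s = t := by
  rw [eventual_value_forward hw hwC hpC hf hu hz ht,
    eventual_value_backward hw hwC hpC hC hf hu hm hx hs]
  have hred : FreeGroup.IsReduced (p ++ FreeGroup.invRev u) := by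
    rcases List.eq_nil_or_concat u with rfl | ⟨u, y, rfl⟩
    · simpa [FreeGroup.invRev] using hx.infix ⟨[], [x.bar], rfl⟩
    · have hyx : y = x := by
        have := congrArg List.getLast? hm
        rw [List.concat_eq_append, ← List.append_assoc, List.getLast?_concat,
          List.getLast?_concat] at this
        exact Option.some_injective _ this
      subst hyx
      have hur := hw.isReduced.infix (L₁ := u ++ [y]) ⟨[], z :: v, by simp [hu]⟩
      rw [List.concat_eq_append, invRev_append, invRev_singleton, ← List.append_assoc]
      refine FreeGroup.IsReduced.append_overlap hx ?_ (by simp)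
      rw [← invRev_singleton, ← invRev_append]
      exact isReduced_invRev hur
  rw [← hf _ (mk_ne_one_of_isReduced hred _)]
  · rw [mk_append, mk_append, ← FreeGroup.inv_mk, hu, mk_append u, mul_assoc,
      inv_mul_cancel_left]
  · rcases hpu with h | h
    · simp [h]
    · intro h'
      simp [FreeGroup.invRev, h] at h'

theorem exists_eventuallyOnCone (hw : FreeGroup.IsCyclicallyReduced w)
    (hwC : ∀ x ∈ w, x ∈ C) (hC : ∀ x ∈ C, x.bar ∈ C)
    (hf : ∀ g, g ≠ 1 → f (g * FreeGroup.mk w) = f g)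
    (hfin : ∀ x, {g | f (g * x) ≠ f g}.Finite)
    (hcut : ∀ a ∈ C, ¬ IsCutVertex (whiteheadGraph w) a)
    (hreach : ∀ a ∈ C, ∀ v, (whiteheadGraph w).Reachable a v ↔ v ∈ C)
    (hadj : ∀ a ∈ C, ∃ b, (whiteheadGraph w).Adj a b)
    (p : List (Letter n)) (hp : p ≠ []) (hpr : FreeGroup.IsReduced p) (hpC : ∀ x ∈ p, x ∈ C) :
    ∃ t, EventuallyOnCone f C p t := by
  classical
  obtain ⟨N, hN⟩ := exists_eventuallyOnCone_of_length_ge hfin (C := C)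
  induction hk : N - p.length generalizing p with
  | zero => exact ⟨_, hN p (by omega)⟩
  | succ k ih =>
    have hgood : ∀ y : Letter n, ∃ t, y ∈ C → FreeGroup.IsReduced (p ++ [y]) →
        EventuallyOnCone f C (p ++ [y]) t := by
      intro y
      by_cases h : y ∈ C ∧ FreeGroup.IsReduced (p ++ [y])
      · obtain ⟨t, ht⟩ := ih (p ++ [y]) (by simp) h.2
          (fun x hx => by
            rcases List.mem_append.1 hx with hx | hx
            · exact hpC x hx
            · rw [List.mem_singleton.1 hx]; exact h.1) (by simp; omega)
        exact ⟨t, fun _ _ => ht⟩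
      · exact ⟨f 1, fun h1 h2 => absurd ⟨h1, h2⟩ h⟩
    choose h hh using hgood
    obtain ⟨q, x, rfl⟩ := (List.eq_nil_or_concat p).resolve_left hp
    rw [List.concat_eq_append] at *
    have hxC : x.bar ∈ C := hC x (hpC x (by simp))
    have hred : ∀ y, FreeGroup.IsReduced (q ++ [x] ++ [y]) ↔ y ≠ x.bar := fun y => by
      rw [isReduced_append_singleton_iff, and_iff_right hpr]
    have hturn : ∀ y z, y ∈ C → z ∈ C → y ≠ x.bar → z ≠ x.bar →
        CyclicallyConsecutive w y.bar z → h y = h z := by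
      intro y z hy hz hyx hzx hyz
      obtain ⟨u, v, m, hu, hm⟩ := hyz.exists_split
      have hs := hh y hy ((hred y).2 hyx)
      rw [← y.bar_bar] at hs
      have := eventual_values_eq_of_turn hw hwC hC hf hpC hu hm ((hred z).2 hzx)
        (by rw [Letter.bar_bar]; exact (hred y).2 hyx) (Or.inl hp) hs
        (hh z hz ((hred z).2 hzx))
      simpa using this
    by_cases hex : ∃ y ∈ C, y ≠ x.bar
    · obtain ⟨y, hy, hyx⟩ := hex
      refine ⟨h y, EventuallyOnCone.of_extensions fun z hz hzr => ?_⟩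
      have hzx := (hred z).1 hzr
      have : h y = h z := by
        refine eq_of_forall_adj (hcut _ hxC) (hadj _ hxC) (fun y z hy hz hyx hzx hyz => ?_)
          ((hreach _ hxC y).2 hy) hyx ((hreach _ hxC z).2 hz) hzx
        rw [hreach _ hxC] at hy hz
        rcases whiteheadGraph_adj hyz with h1 | h1
        · exact hturn y z hy hz hyx hzx h1
        · exact (hturn z y hz hy hzx hyx h1).symm
      rw [this]
      exact hh z hz hzr
    -- No letter of `C` extends `p`, so any value would do.
    · refine ⟨f 1, EventuallyOnCone.of_extensions fun z hz hzr => ?_⟩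
      exact absurd ⟨z, hz, (hred z).1 hzr⟩ hex

end Values

/-- **Whitehead's cut vertex lemma**. -/
theorem exists_isCutVertex_of_isPrimitive {w : List (Letter n)}
    (hw : FreeGroup.IsCyclicallyReduced w) (hprim : IsPrimitive (FreeGroup.mk w))
    (hl : w.length ≠ 1) : ∃ a, IsCutVertex (whiteheadGraph w) a := by
  by_contra hcut
  rw [not_exists] at hcut
  obtain ⟨ι, B, i₀, hB⟩ := hprim
  obtain ⟨f, hf, hf1, hfin⟩ := exists_jump_function B i₀
  rw [hB] at hf hf1
  cases w with
  | nil => exact hf1 (by rw [FreeGroup.one_eq_mk])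
  | cons b w =>
  set W := b :: w with hW
  set G := whiteheadGraph W
  obtain ⟨m, l, hm⟩ : ∃ m l, W = m ++ [l] := by
    rcases List.eq_nil_or_concat W with h | ⟨m, l, h⟩
    · simp [hW] at h
    · exact ⟨m, l, by rw [h, List.concat_eq_append]⟩
  have hfirst : CyclicallyConsecutive W l b :=
    cyclicallyConsecutive_of_split (u := []) (v := w) (m := m) (by rw [List.append_nil, ← hm])
  have hlb : G.Adj l.bar b := hfirst.adj hw
  -- Arcs control the values of `f` only in directions of this component, which is why cones are
  -- restricted to words in `C`.
  let C : Set (Letter n) := {v | G.Reachable b v}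
  have hadj : ∀ a ∈ C, ∃ c, G.Adj a c := fun a ha =>
    exists_adj_of_reachable ha ⟨_, hlb.symm⟩
  have hwC : ∀ x ∈ W, x ∈ C := fun x hx => reachable_of_mem hw hcut ⟨_, hlb.symm⟩ hx
  have hC : ∀ x ∈ C, x.bar ∈ C := fun x hx =>
    SimpleGraph.Reachable.trans hx (reachable_bar (hcut x) (hadj x hx))
  have hreach : ∀ a ∈ C, ∀ v, G.Reachable a v ↔ v ∈ C := fun a ha v =>
    ⟨fun h => SimpleGraph.Reachable.trans ha h,
      fun h => (SimpleGraph.Reachable.symm ha).trans h⟩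
  have hgood : ∀ y : Letter n, ∃ t, y ∈ C → EventuallyOnCone f C ([] ++ [y]) t := by
    intro y
    by_cases hy : y ∈ C
    · obtain ⟨t, ht⟩ := exists_eventuallyOnCone hw hwC hC hf hfin (fun a _ => hcut a) hreach hadj
        [y] (by simp) FreeGroup.IsReduced.singleton (by simpa using hy)
      exact ⟨t, fun _ => ht⟩
    · exact ⟨0, fun h => absurd h hy⟩
  choose h hh using hgood
  have hbC : b ∈ C := SimpleGraph.Reachable.refl b
  have hlC : l.bar ∈ C := hC l (hwC l (by simp [hm]))
  have hb : h b = f (FreeGroup.mk W) :=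
    eventual_value_forward (u := []) hw hwC (by simp) hf rfl FreeGroup.IsReduced.singleton (hh b hbC)
  have hl1 : h l.bar = f 1 :=
    eventual_value_backward (u := []) (z := b) (v := w) hw hwC (by simp) hC hf rfl
      (by rw [List.append_nil]; exact hm) FreeGroup.IsReduced.singleton (hh _ hlC)
  have hne : h l.bar ≠ h b := by rw [hb, hl1]; exact hf1.symm
  have hturn : ∀ y z, y ∈ C → z ∈ C → CyclicallyConsecutive W y.bar z →
      (y = l.bar ∧ z = b) ∨ h y = h z := by
    intro y z hy hz hyz
    obtain ⟨u, v, m', hu, hm'⟩ := hyz.exists_split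
    by_cases hu0 : u = []
    · subst hu0
      left
      rw [List.append_nil, ← List.nil_append (z :: v), ← hu, hm] at hm'
      have h1 := (List.append_inj' hm' rfl).2
      have h2 : z = b := by simpa [hW] using (congrArg List.head? hu).symm
      refine ⟨?_, h2⟩
      rw [List.singleton_inj.1 h1, Letter.bar_bar]
    · right
      have hs := hh y hy
      rw [← y.bar_bar] at hs
      simpa using eventual_values_eq_of_turn hw hwC hC hf (p := []) (by simp) hu hm'
        FreeGroup.IsReduced.singleton FreeGroup.IsReduced.singleton (Or.inr hu0) hs (hh z hz)
  have hedge : ∀ y z, y ∈ C → z ∈ C → G.Adj y z →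
      (y = l.bar ∧ z = b) ∨ (y = b ∧ z = l.bar) ∨ h y = h z := by
    intro y z hy hz hyz
    rcases whiteheadGraph_adj hyz with h1 | h1
    · rcases hturn y z hy hz h1 with h2 | h2
      · exact Or.inl h2
      · exact Or.inr (Or.inr h2)
    · rcases hturn z y hz hy h1 with h2 | h2
      · exact Or.inr (Or.inl h2.symm)
      · exact Or.inr (Or.inr h2.symm)
  -- Deleting either end of the jumping arc removes it, so `h` is constant on the rest of `C`. A
  -- third letter in `C` would then link the two ends.
  have hconst : ∀ a ∈ C, a = b ∨ a = l.bar → ∀ y z, y ∈ C → z ∈ C → y ≠ a → z ≠ a →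
      h y = h z := by
    intro a ha hab y z hy hz hya hza
    refine eq_of_forall_adj (hcut a) (hadj a ha) (fun y z hy hz hya hza hyz => ?_)
      ((hreach a ha y).2 hy) hya ((hreach a ha z).2 hz) hza
    rcases hedge y z ((hreach a ha y).1 hy) ((hreach a ha z).1 hz) hyz with h1 | h1 | h1
    · rcases hab with rfl | rfl
      · exact absurd h1.2 hza
      · exact absurd h1.1 hya
    · rcases hab with rfl | rfl
      · exact absurd h1.1 hya
      · exact absurd h1.2 hza
    · exact h1
  have hlb' : l.bar ≠ b := hlb.ne
  have hCeq : ∀ x ∈ C, x = b ∨ x = l.bar := by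
    intro x hx
    by_contra hc
    rw [not_or] at hc
    refine hne ?_
    rw [hconst b hbC (Or.inl rfl) l.bar x hlC hx hlb' hc.1,
      hconst l.bar hlC (Or.inr rfl) b x hbC hx hlb'.symm hc.2]
  have hbl : b = l := by
    refine Letter.bar_injective ((hCeq _ (hC b hbC)).resolve_left b.bar_ne)
  subst hbl
  cases w with
  | nil => exact hl rfl
  | cons c w =>
    -- The word begins with the same letter twice; this turn joins the same two directions as the
    -- jumping one but has `u` nonempty, so it preserves `h`.
    have hbc : CyclicallyConsecutive W b c := ⟨0, by simp [hW], by simp [hW]⟩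
    have hcC : c ∈ C := hwC c (by simp [hW])
    obtain rfl : c = b := (hCeq c hcC).resolve_right (hbc.ne_bar hw)
    have hs := hh _ hlC
    exact hne (eventual_values_eq_of_turn hw hwC hC hf (p := []) (u := [c]) (v := w)
      (m := c :: w) (by simp) rfl rfl FreeGroup.IsReduced.singleton
        FreeGroup.IsReduced.singleton (Or.inr (by simp)) hs (hh c hcC))

/-! ### Cyclic length -/

/-- Powers of a cyclically reduced word grow by exactly its length, while conjugation costs a
bounded amount; the power `m` is chosen to exceed `2 * c.norm`. -/
theorem length_le_of_conj {L K : List (Letter n)} (hL : FreeGroup.IsCyclicallyReduced L)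
    {c : FreeGroup (Fin n)} (h : FreeGroup.mk L = c * FreeGroup.mk K * c⁻¹) :
    L.length ≤ K.length := by
  by_contra! hlt
  set m := 2 * c.norm + 1 with hm
  have h1 : (FreeGroup.mk L ^ m).norm = m * L.length := by
    rw [FreeGroup.norm, FreeGroup.toWord_pow, FreeGroup.toWord_mk, hL.isReduced.reduce_eq,
      (hL.flatten_replicate m).isReduced.reduce_eq]
    simp
  have h2 : (FreeGroup.mk K ^ m).norm ≤ m * K.length := by
    rw [FreeGroup.pow_mk]
    refine FreeGroup.norm_mk_le.trans ?_
    simp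
  have h3 : (FreeGroup.mk L ^ m).norm ≤ 2 * c.norm + m * K.length := by
    rw [h, conj_pow]
    have h4 := FreeGroup.norm_mul_le (c * FreeGroup.mk K ^ m) c⁻¹
    have h5 := FreeGroup.norm_mul_le c (FreeGroup.mk K ^ m)
    rw [FreeGroup.norm_inv_eq] at h4
    omega
  have h6 : m * (K.length + 1) ≤ m * L.length := Nat.mul_le_mul_left m hlt
  rw [mul_add] at h6
  omega

theorem mk_eq_conj_reduceCyclically (L : List (Letter n)) :
    FreeGroup.mk L = FreeGroup.mk (FreeGroup.reduceCyclically.conjugator L) *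
      FreeGroup.mk (FreeGroup.reduceCyclically L) *
        (FreeGroup.mk (FreeGroup.reduceCyclically.conjugator L))⁻¹ := by
  rw [FreeGroup.inv_mk, ← mk_append, ← mk_append,
    FreeGroup.reduceCyclically.conj_conjugator_reduceCyclically]

theorem cyclicLength_le_of_conj {K : List (Letter n)} {g c : FreeGroup (Fin n)}
    (h : g = c * FreeGroup.mk K * c⁻¹) : cyclicLength g ≤ K.length := by
  have e := mk_eq_conj_reduceCyclically g.toWord
  rw [FreeGroup.mk_toWord] at e
  refine length_le_of_conj
    (FreeGroup.reduceCyclically.isCyclicallyReduced FreeGroup.isReduced_toWord)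
    (c := (FreeGroup.mk (FreeGroup.reduceCyclically.conjugator g.toWord))⁻¹ * c) ?_
  rw [mul_inv_rev, inv_inv, show ∀ a b d e k : FreeGroup (Fin n),
    a * b * k * (d * e) = a * (b * k * d) * e by intros; group, ← h]
  nth_rewrite 3 [e]
  group

theorem length_le_cyclicLength {w : List (Letter n)} (hw : FreeGroup.IsCyclicallyReduced w) :
    w.length ≤ cyclicLength (FreeGroup.mk w) := by
  have e := mk_eq_conj_reduceCyclically (FreeGroup.mk w).toWord
  rw [FreeGroup.mk_toWord] at e
  exact length_le_of_conj hw e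

/-! ### The Whitehead automorphism of a cut vertex -/

theorem IsCutVertex.exists_whiteheadData {G : SimpleGraph (Letter n)} {a : Letter n}
    (h : IsCutVertex G a) : ∃ φ : WhiteheadData n,
      (∀ x ∈ φ.A, ∀ y, G.Adj x y → y ∈ φ.A ∨ y = φ.a) ∧ ∃ x ∈ φ.A, G.Adj x φ.a := by
  classical
  suffices hS : ∃ S : Set (Letter n), a ∉ S ∧ a.bar ∉ S ∧
      (∀ x ∈ S, ∀ y, G.Adj x y → y ∈ S ∨ y = a) ∧ ∃ x ∈ S, G.Reachable x a by
    obtain ⟨S, h1, h2, h3, x, hx, ⟨p⟩⟩ := hS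
    refine ⟨⟨a, S.toFinset, by simpa using h1, by simpa using h2⟩, by simpa using h3, ?_⟩
    obtain ⟨d, -, hd, hd'⟩ := p.exists_boundary_dart S hx h1
    refine ⟨d.fst, by simpa using hd, ?_⟩
    have hda : d.snd = a := (h3 _ hd _ d.adj).resolve_left hd'
    exact hda ▸ d.adj
  obtain ⟨⟨b, hb⟩, h⟩ := h
  -- If `a.bar` lies in the component of `a`, take a piece of that component minus `a` which misses
  -- `a.bar`; otherwise take the whole component minus `a`.
  by_cases hbar : G.Reachable a a.bar
  · have h := h.resolve_left (not_not.2 hbar)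
    set T := {v | G.Reachable a v ∧ v ≠ a} with hT
    have hbT : a.bar ∈ T := ⟨hbar, a.bar_ne⟩
    obtain ⟨p, hp⟩ : ∃ p : T, ¬ (G.induce T).Reachable p ⟨a.bar, hbT⟩ := by
      by_contra! hc
      exact h fun p q => (hc p).trans (hc q).symm
    refine ⟨{v | ∃ hv : v ∈ T, (G.induce T).Reachable p ⟨v, hv⟩}, fun ⟨hv, _⟩ => hv.2 rfl,
      fun ⟨_, hv⟩ => hp hv, fun x ⟨hx, hpx⟩ y hxy => ?_,
      p, ⟨p.2, SimpleGraph.Reachable.refl _⟩, p.2.1.symm⟩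
    by_cases hya : y = a
    · exact Or.inr hya
    · refine Or.inl ⟨⟨hx.1.trans hxy.reachable, hya⟩, hpx.trans ?_⟩
      exact SimpleGraph.Adj.reachable (G := G.induce T) (u := ⟨x, hx⟩) hxy
  · refine ⟨{v | G.Reachable a v ∧ v ≠ a}, fun hv => hv.2 rfl, fun hv => hbar hv.1,
      fun x hx y hxy => ?_, b, ⟨hb.reachable, hb.ne'⟩, hb.symm.reachable⟩
    by_cases hya : y = a
    · exact Or.inr hya
    · exact Or.inl ⟨hx.1.trans hxy.reachable, hya⟩

namespace WhiteheadData

/-- The turn from `y` to `z` does not leave `φ.A` except through the vertex `φ.a`. -/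
def IsAdaptedTurn (φ : WhiteheadData n) (y z : Letter n) : Prop :=
  z ≠ y.bar ∧ (y.bar ∈ φ.A → z ∈ φ.A ∨ z = φ.a) ∧ (z ∈ φ.A → y.bar ∈ φ.A ∨ y.bar = φ.a)

/-- The letter `φ.a.bar`, where it is carried over from the image of `y` to that of the next
letter. -/
def pending (φ : WhiteheadData n) (y : Letter n) : List (Letter n) :=
  if y.bar ∈ φ.A ∨ y.bar = φ.a then [φ.a.bar] else []

theorem mk_bar (x : Letter n) : FreeGroup.mk [x.bar] = (FreeGroup.mk [x])⁻¹ := by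
  rw [FreeGroup.inv_mk, invRev_singleton]

/-- Bookkeeping of lengths: a pending `φ.a.bar` that was added costs nothing, since it must cancel,
while an original one is paid for one step later. Hence the indicators of `φ.a.bar` telescope around
the cycle; the remaining indicator records the letter saved at a turn between `φ.A` and `φ.a`. -/
theorem exists_pending_step (φ : WhiteheadData n) {y z : Letter n} (h : φ.IsAdaptedTurn y z) :
    ∃ K : List (Letter n),
      FreeGroup.mk (φ.pending y) * φ.toAut (FreeGroup.mk [z]) =
        FreeGroup.mk K * FreeGroup.mk (φ.pending z) ∧
      K.length + (if z = φ.a.bar then 1 else 0) +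
        (if y.bar ∈ φ.A ∧ z = φ.a ∨ y.bar = φ.a ∧ z ∈ φ.A then 1 else 0) ≤
          1 + (if y = φ.a.bar then 1 else 0) := by
  obtain ⟨h0, h1, h2⟩ := h
  have ha := φ.a_notMem
  have hb := φ.bar_a_notMem
  have hy : y = φ.a.bar ↔ y.bar = φ.a := by
    rw [← Letter.bar_injective.eq_iff, Letter.bar_bar]
  have hab := φ.a.bar_ne
  simp only [hy, ← mk_letterImage]
  by_cases hza : z = φ.a
  · subst hza
    have hya : y.bar ≠ φ.a := h0.symm
    by_cases hyA : y.bar ∈ φ.A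
    · refine ⟨[], ?_, ?_⟩
      · simp [pending, letterImage, hyA, ha, hb, hab, mk_bar, -FreeGroup.inv_mk,
          ← FreeGroup.one_eq_mk]
      · simp [hyA, hab.symm]
    · refine ⟨[φ.a], ?_, ?_⟩
      · simp [pending, letterImage, hyA, hya, ha, hb, hab]
      · simp [hyA, hya, hab.symm]
  by_cases hzb : z = φ.a.bar
  · subst hzb
    by_cases hya : y.bar = φ.a
    · refine ⟨[φ.a.bar], ?_, ?_⟩
      · simp [pending, letterImage, hya, ha, hb]
      · simp [hya, ha, hb]
    · have hyA : y.bar ∉ φ.A := fun h => by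
        rcases h1 h with h | h
        · exact hb h
        · exact hza h
      refine ⟨[], ?_, ?_⟩
      · simp [pending, letterImage, hya, hyA, ha, hb]
      · simp [hya, hyA]
  have hzb' : z.bar ≠ φ.a := fun h => hzb (by rw [← h, Letter.bar_bar])
  have himg : FreeGroup.mk ((φ.letterImage z).map MarkedLetter.letter) =
      (if z ∈ φ.A then FreeGroup.mk [φ.a] else 1) * FreeGroup.mk [z] *
        FreeGroup.mk (φ.pending z) := by
    by_cases hzA : z ∈ φ.A <;> by_cases hzA' : z.bar ∈ φ.A <;>
      simp [letterImage, pending, hzA, hzA', hzb', ← FreeGroup.one_eq_mk]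
  rw [himg]
  by_cases hzA : z ∈ φ.A
  · refine ⟨[z], ?_, ?_⟩
    · have hpy : φ.pending y = [φ.a.bar] := if_pos (h2 hzA)
      rw [hpy, if_pos hzA, mk_bar, mul_assoc, inv_mul_cancel_left]
    · simp [hzb, hza, hzA]
  · have hyA : y.bar ∉ φ.A := fun h => (h1 h).elim hzA hza
    rw [if_neg hzA, one_mul]
    by_cases hya : y.bar = φ.a
    · refine ⟨[φ.a.bar, z], ?_, by simp [hya, hzA, hzb, hza]⟩
      have hpy : φ.pending y = [φ.a.bar] := if_pos (Or.inr hya)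
      rw [hpy, ← mul_assoc, ← mk_append, List.singleton_append]
    · refine ⟨[z], ?_, by simp [hya, hzA, hzb, hza]⟩
      have hpy : φ.pending y = [] := if_neg (by simp [hya, hyA])
      rw [hpy, ← FreeGroup.one_eq_mk, one_mul]

theorem exists_pending_chain (φ : WhiteheadData n) (l : List (Letter n)) (y : Letter n)
    (h : List.IsChain φ.IsAdaptedTurn (y :: l)) :
    ∃ K : List (Letter n),
      FreeGroup.mk (φ.pending y) * φ.toAut (FreeGroup.mk l) =
        FreeGroup.mk K * FreeGroup.mk (φ.pending ((y :: l).getLast (List.cons_ne_nil _ _))) ∧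
      K.length + (if (y :: l).getLast (List.cons_ne_nil _ _) = φ.a.bar then 1 else 0) ≤
          l.length + (if y = φ.a.bar then 1 else 0) := by
  induction l generalizing y with
  | nil => exact ⟨[], by simp [← FreeGroup.one_eq_mk], le_rfl⟩
  | cons z l ih =>
    rw [List.isChain_cons_cons] at h
    obtain ⟨K₁, e₁, l₁⟩ := φ.exists_pending_step h.1
    obtain ⟨K₂, e₂, l₂⟩ := ih z h.2
    refine ⟨K₁ ++ K₂, ?_, ?_⟩
    · rw [← List.singleton_append, mk_append, map_mul, ← mul_assoc, e₁, mul_assoc, e₂, mk_append,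
        mul_assoc]
      rfl
    · rw [List.getLast_cons_cons]
      simp only [List.length_append, List.length_cons]
      omega

/-- Every turn of the cyclic word `w` is adapted to `φ`. -/
def IsAdapted (φ : WhiteheadData n) (w : List (Letter n)) : Prop :=
  ∀ y z, CyclicallyConsecutive w y z → φ.IsAdaptedTurn y z

theorem cyclicLength_toAut_lt (φ : WhiteheadData n) {w : List (Letter n)}
    (hφ : φ.IsAdapted w) {y z : Letter n} (hyz : CyclicallyConsecutive w y z)
    (hs : y.bar ∈ φ.A ∧ z = φ.a ∨ y.bar = φ.a ∧ z ∈ φ.A) :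
    cyclicLength (φ.toAut (FreeGroup.mk w)) < w.length := by
  -- Rotate `w` so that the saving turn is the seam; conjugating by the pending letter closes up the
  -- telescoping sum.
  obtain ⟨u, v, m, hu, hm⟩ := hyz.exists_split
  have hchain : List.IsChain φ.IsAdaptedTurn w := by
    rw [List.isChain_iff_getElem]
    intro i hi
    refine hφ _ _ ⟨i, List.getElem?_eq_getElem _, ?_⟩
    rw [Nat.mod_eq_of_lt hi]
    exact List.getElem?_eq_getElem _
  have hchain' : List.IsChain φ.IsAdaptedTurn (z :: (v ++ u)) := by
    rw [hu, List.isChain_append] at hchain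
    rw [← List.cons_append, List.isChain_append]
    refine ⟨hchain.2.1, hchain.1, fun p hp q hq => hφ _ _ ?_⟩
    obtain ⟨m', hm'⟩ := List.mem_getLast?_eq_getLast hp
    cases u with
    | nil => simp at hq
    | cons b u =>
      obtain rfl : b = q := by simpa using hq
      have e : z :: v = (z :: v).dropLast ++ [p] := by
        rw [hm']; exact (List.dropLast_append_getLast _).symm
      have := cyclicallyConsecutive_of_split (u := []) (v := u ++ z :: v)
        (m := b :: u ++ (z :: v).dropLast) (x := p) (z := b) (by
          rw [List.append_nil, List.append_assoc, ← e, List.cons_append])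
      rwa [hu]
  obtain ⟨K₁, e₁, l₁⟩ := φ.exists_pending_step (hφ y z hyz)
  obtain ⟨K₂, e₂, l₂⟩ := φ.exists_pending_chain (v ++ u) z hchain'
  have hlast : (z :: (v ++ u)).getLast (List.cons_ne_nil _ _) = y := by
    simp only [← List.cons_append, hm, List.getLast_concat]
  rw [hlast] at e₂ l₂
  rw [if_pos hs] at l₁
  have hlen : (K₁ ++ K₂).length < w.length := by
    simp only [hu, List.length_append, List.length_cons] at l₂ ⊢
    omega
  refine lt_of_le_of_lt (cyclicLength_le_of_conj (K := K₁ ++ K₂)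
    (c := φ.toAut (FreeGroup.mk u) * (FreeGroup.mk (φ.pending y))⁻¹) ?_) hlen
  have e₃ : FreeGroup.mk (K₁ ++ K₂) = FreeGroup.mk (φ.pending y) *
      φ.toAut (FreeGroup.mk (z :: v ++ u)) * (FreeGroup.mk (φ.pending y))⁻¹ := by
    rw [eq_mul_inv_iff_mul_eq, mk_append, mul_assoc, ← e₂, ← mul_assoc, ← e₁, mul_assoc, ← map_mul,
      ← mk_append]
    rfl
  rw [e₃, hu, mk_append, mk_append, map_mul, map_mul]
  group

/-! ### Cancellation of the added letters -/

theorem exists_of_added (φ : WhiteheadData n) {w : List (Letter n)} {k : ℕ} {y : MarkedLetter n}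
    (hk : (φ.wordImage w)[k]? = some y) (hy : y.added = true) :
    ∃ u x v J, w = u ++ x :: v ∧
      (x ∈ φ.A ∧ y.letter = φ.a ∧ φ.letterImage x = y :: J ∧ k = (φ.wordImage u).length ∨
        x.bar ∈ φ.A ∧ y.letter = φ.a.bar ∧ φ.letterImage x = J ++ [y] ∧
          k = (φ.wordImage u ++ J).length) := by
  induction w generalizing k with
  | nil => simp [wordImage] at hk
  | cons x w ih =>
    rw [wordImage, List.flatMap_cons, ← wordImage] at hk
    by_cases hkl : k < (φ.letterImage x).length
    · rw [List.getElem?_append_left hkl] at hk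
      have key : ∃ J, (x ∈ φ.A ∧ y.letter = φ.a ∧ φ.letterImage x = y :: J ∧ k = 0) ∨
          (x.bar ∈ φ.A ∧ y.letter = φ.a.bar ∧ φ.letterImage x = J ++ [y] ∧ k = J.length) := by
        by_cases h1 : x ∈ φ.A <;> by_cases h2 : x.bar ∈ φ.A <;>
          simp only [letterImage, h1, h2, if_true, if_false] at hk hkl ⊢ <;>
          rcases k with _ | _ | _ | k <;> simp at hk hkl <;> subst hk <;> simp at hy ⊢
        · exact ⟨[⟨φ.a, true⟩, ⟨x, false⟩], by simp⟩
        · exact ⟨[⟨x, false⟩], by simp⟩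
      obtain ⟨J, h⟩ := key
      exact ⟨[], x, w, J, rfl, by simpa [wordImage] using h⟩
    · rw [List.getElem?_append_right (not_lt.1 hkl)] at hk
      obtain ⟨u, x', v, J, rfl, h⟩ := ih hk
      refine ⟨x :: u, x', v, J, rfl, ?_⟩
      refine h.imp (fun h => ⟨h.1, h.2.1, h.2.2.1, ?_⟩) (fun h => ⟨h.1, h.2.1, h.2.2.1, ?_⟩)
      · have := h.2.2.2
        rw [wordImage, List.flatMap_cons, ← wordImage, List.length_append]
        omega
      · have := h.2.2.2
        rw [wordImage, List.flatMap_cons, ← wordImage, List.append_assoc, List.length_append]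
        omega

theorem wordImage_append (φ : WhiteheadData n) (u v : List (Letter n)) :
    φ.wordImage (u ++ v) = φ.wordImage u ++ φ.wordImage v := List.flatMap_append

theorem wordImage_cons (φ : WhiteheadData n) (x : Letter n) (v : List (Letter n)) :
    φ.wordImage (x :: v) = φ.letterImage x ++ φ.wordImage v := List.flatMap_cons

theorem exists_letterImage_eq_cons (φ : WhiteheadData n) {z : Letter n}
    (hz : z ∈ φ.A ∨ z = φ.a) : ∃ q J, φ.letterImage z = q :: J ∧ q.letter = φ.a := by
  by_cases h : z ∈ φ.A
  · exact ⟨⟨φ.a, true⟩, _, by rw [letterImage, if_pos h]; rfl, rfl⟩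
  · exact ⟨⟨z, false⟩, _, by rw [letterImage, if_neg h]; rfl, hz.resolve_left h⟩

theorem exists_letterImage_eq_concat (φ : WhiteheadData n) {z : Letter n}
    (hz : z.bar ∈ φ.A ∨ z.bar = φ.a) :
    ∃ q J, φ.letterImage z = J ++ [q] ∧ q.letter = φ.a.bar := by
  by_cases h : z.bar ∈ φ.A
  · exact ⟨⟨φ.a.bar, true⟩, _, by rw [letterImage, if_pos h], rfl⟩
  · refine ⟨⟨z, false⟩, _, by rw [letterImage, if_neg h, List.append_nil], ?_⟩
    rw [← hz.resolve_left h, Letter.bar_bar]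

theorem getElem?_succ_mod {α : Type*} {S₁ S₂ R : List α} {y q : α}
    (h : S₂ ++ (S₁ ++ [y]) = q :: R) :
    (S₁ ++ y :: S₂)[(S₁.length + 1) % (S₁ ++ y :: S₂).length]? = some q := by
  cases S₂ with
  | nil =>
    rw [List.nil_append] at h
    have hl : S₁.length + 1 = (S₁ ++ [y]).length := by simp
    rw [hl, Nat.mod_self, h]
    rfl
  | cons b S₂ =>
    obtain rfl : b = q := by simpa using congrArg List.head? h
    rw [Nat.mod_eq_of_lt (by simp)]
    simp

theorem addedLettersCancel_wordImage (φ : WhiteheadData n) {w : List (Letter n)}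
    (hφ : φ.IsAdapted w) : AddedLettersCancel (φ.wordImage w) := by
  -- Only pairs reading `φ.a.bar`, `φ.a` in this order are taken. Two of them cannot overlap, as the
  -- shared letter would equal its own inverse.
  refine ⟨{i | ∃ y z, (φ.wordImage w)[i]? = some y ∧
    (φ.wordImage w)[(i + 1) % (φ.wordImage w).length]? = some z ∧
    y.letter = φ.a.bar ∧ z.letter = φ.a}, ?_, ?_, ?_⟩
  · rintro i ⟨y, z, hy, hz, h1, h2⟩
    exact ⟨y, z, hy, hz, by rw [h1, h2, Letter.bar_bar]⟩
  · rintro i ⟨y, z, hy, hz, h1, h2⟩ ⟨y', z', hy', -, h1', -⟩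
    rw [hz] at hy'
    obtain rfl := Option.some_injective _ hy'
    exact φ.a.bar_ne (h1'.symm.trans h2)
  · intro k y hk hy
    obtain ⟨u, x, v, J, rfl, ⟨hx, hya, hJ, rfl⟩ | ⟨hx, hya, hJ, rfl⟩⟩ := φ.exists_of_added hk hy
    · obtain ⟨m, q, hm⟩ := (List.eq_nil_or_concat (x :: v ++ u)).resolve_left (by simp)
      rw [List.concat_eq_append] at hm
      obtain ⟨q', J', hJ', hq'⟩ := φ.exists_letterImage_eq_concat
        ((hφ q x (cyclicallyConsecutive_of_split hm)).2.2 hx)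
      have e : φ.wordImage (u ++ x :: v) = φ.wordImage u ++ y :: (J ++ φ.wordImage v) := by
        rw [wordImage_append, wordImage_cons, hJ, List.cons_append]
      obtain ⟨i, hi, hi'⟩ := exists_getElem?_of_split (u := φ.wordImage u) (z := y)
        (v := J ++ φ.wordImage v) (m := φ.wordImage m ++ J') (x := q') (by
          have := congrArg φ.wordImage hm
          rw [wordImage_append, wordImage_cons, wordImage_append, wordImage_cons, hJ, hJ'] at this
          simpa [wordImage] using this)
      rw [← e] at hi hi'
      exact ⟨i, ⟨q', y, hi, by rw [hi']; exact hk, hq', hya⟩, Or.inr hi'.symm⟩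
    · obtain ⟨z, r, hr⟩ : ∃ z r, v ++ (u ++ [x]) = z :: r :=
        List.exists_cons_of_ne_nil (by simp)
      have hxz : CyclicallyConsecutive (u ++ x :: v) x z := by
        refine ⟨u.length, by simp, getElem?_succ_mod hr⟩
      obtain ⟨q, J', hJ', hq⟩ := φ.exists_letterImage_eq_cons ((hφ x z hxz).2.1 hx)
      have e : φ.wordImage (u ++ x :: v) = φ.wordImage u ++ J ++ y :: φ.wordImage v := by
        rw [wordImage_append, wordImage_cons, hJ]; simp
      refine ⟨_, ⟨y, q, hk, ?_, hya, hq⟩, Or.inl rfl⟩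
      rw [e]
      refine getElem?_succ_mod (R := J' ++ φ.wordImage r) ?_
      have := congrArg φ.wordImage hr
      rw [wordImage_append, wordImage_append, wordImage_cons, wordImage_cons, hJ, hJ'] at this
      simpa [wordImage] using this

end WhiteheadData

/-! ### From a cut vertex to a shortening automorphism. -/

theorem exists_whiteheadData_of_isCutVertex {w : List (Letter n)}
    (hw : FreeGroup.IsCyclicallyReduced w) {a : Letter n}
    (ha : IsCutVertex (whiteheadGraph w) a) :
    ∃ φ : WhiteheadData n,
      cyclicLength (φ.toAut (FreeGroup.mk w)) < cyclicLength (FreeGroup.mk w) ∧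
        AddedLettersCancel (φ.wordImage w) := by
  obtain ⟨φ, hA, x, hx, hadj⟩ := ha.exists_whiteheadData
  have hφ : φ.IsAdapted w := fun y z hyz =>
    ⟨hyz.ne_bar hw, fun h => hA _ h _ (hyz.adj hw), fun h => hA _ h _ (hyz.adj hw).symm⟩
  refine ⟨φ, lt_of_lt_of_le ?_ (length_le_cyclicLength hw), φ.addedLettersCancel_wordImage hφ⟩
  -- The arc between `φ.A` and `φ.a` comes from a turn in one of two directions; either one saves a
  -- letter.
  rcases whiteheadGraph_adj hadj with h | h
  · exact φ.cyclicLength_toAut_lt hφ h (Or.inl ⟨by rwa [Letter.bar_bar], rfl⟩)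
  · exact φ.cyclicLength_toAut_lt hφ h (Or.inr ⟨Letter.bar_bar _, hx⟩)

end WhiteheadFine

theorem mainTheorem2 (n : ℕ) (w : List (WhiteheadFine.Letter n))
    (hw : FreeGroup.IsCyclicallyReduced w) :
    (WhiteheadFine.IsPrimitive (FreeGroup.mk w) → w.length ≠ 1 →
      ∃ a, WhiteheadFine.IsCutVertex (WhiteheadFine.whiteheadGraph w) a) ∧
    ((∃ a, WhiteheadFine.IsCutVertex (WhiteheadFine.whiteheadGraph w) a) →
      ∃ φ : WhiteheadFine.WhiteheadData n,
        WhiteheadFine.cyclicLength (φ.toAut (FreeGroup.mk w)) <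
          WhiteheadFine.cyclicLength (FreeGroup.mk w) ∧
        WhiteheadFine.AddedLettersCancel (φ.wordImage w)) :=
  ⟨WhiteheadFine.exists_isCutVertex_of_isPrimitive hw,
    fun ⟨_, ha⟩ => WhiteheadFine.exists_whiteheadData_of_isCutVertex hw ha⟩
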